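/- Let $G$ be a totally disconnected, locally compact topological group and let $\alpha\colon G\to G$ be an automorphism of topological groups. Let $U_\alpha:=\{x\in G:\lim_{n\to\infty}\alpha^n(x)=1\}$ be the contraction group of $\alpha$, let $U_{\alpha^{-1}}$ be that of $\alpha^{-1}$, and let $M_\alpha:=\{x\in G:\{\alpha^n(x):n\in\mathbb Z\}\text{ is relatively compact in }G\}$, which is a subgroup with $\alpha(M_\alpha)=M_\alpha$. For an automorphism $\beta$ of a topological group $H$, a compact open subgroup $V\subseteq H$ is called tidy for $\beta$ if, with $V_+:=\bigcap_{n\ge 0}\beta^n(V)$ and $V_-:=\bigcap_{n\ge 0}\beta^{-n}(V)$, one has $V=V_+V_-$, and both $\bigcup_{n\ge 0}\beta^n(V_+)$ and $\bigcup_{n\ge 0}\beta^{-n}(V_-)$ are closed in $H$. The automorphism $\beta$ is called tidy if every identity neighbourhood of $H$ contains a subgroup tidy for $\beta$. Suppose that $\alpha|_{M_\alpha}$ is tidy, where $M_\alpha$ carries the subspace topology. Then $$K=U_0=\{1\},$$ where $U_0:=\overline{U_\alpha}\cap\overline{U_{\alpha^{-1}}}$ and $$K:=\bigcap_{O}\overline{\{x\in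 M_\alpha:\alpha^n(x)\in O\text{ for all sufficiently large }n\}},$$ the intersection being over all compact open subgroups $O$ of $G$ and the closures being taken in $G$. -/

import Mathlib

open Filter Topology
open scoped Pointwise

/-- The automorphism `α ^ n` for an integer `n`. -/
def autPow {G : Type*} [Group G] [TopologicalSpace G] (α : G ≃ₜ* G) (n : ℤ) : G ≃* G :=
  ((α.toMulEquiv : MulAut G) ^ n : MulAut G)

theorem autPow_zero {G : Type*} [Group G] [TopologicalSpace G] (α : G ≃ₜ* G) (x : G) :
    autPow α 0 x = x := by
  simp [autPow]

theorem autPow_add_one {G : Type*} [Group G] [TopologicalSpace G] (α : G ≃ₜ* G) (n : ℤ) (x : G) :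
    autPow α (n + 1) x = autPow α n (α x) := by
  have h : ((α.toMulEquiv : MulAut G) ^ (n + 1) : MulAut G)
      = (α.toMulEquiv : MulAut G) ^ n * (α.toMulEquiv : MulAut G) := zpow_add_one _ _
  exact DFunLike.congr_fun h x

/-- The subgroup `V₊ = ⋂_{n ≥ 0} α ^ n (V)`. -/
def plusPart {G : Type*} [Group G] [TopologicalSpace G] (α : G ≃ₜ* G) (V : Subgroup G) :
    Subgroup G :=
  ⨅ n : ℕ, V.map (autPow α (n : ℤ)).toMonoidHom

/-- The subgroup `V₋ = ⋂_{n ≥ 0} α ^ (-n) (V)`. -/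
def minusPart {G : Type*} [Group G] [TopologicalSpace G] (α : G ≃ₜ* G) (V : Subgroup G) :
    Subgroup G :=
  ⨅ n : ℕ, V.map (autPow α (-(n : ℤ))).toMonoidHom

/-- `V₊₊ = ⋃_{n ≥ 0} α ^ n (V₊)`. -/
def plusPlus {G : Type*} [Group G] [TopologicalSpace G] (α : G ≃ₜ* G) (V : Subgroup G) : Set G :=
  ⋃ n : ℕ, autPow α (n : ℤ) '' (plusPart α V : Set G)

/-- `V₋₋ = ⋃_{n ≥ 0} α ^ (-n) (V₋)`. -/
def minusMinus {G : Type*} [Group G] [TopologicalSpace G] (α : G ≃ₜ* G) (V : Subgroup G) : Set G :=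
  ⋃ n : ℕ, autPow α (-(n : ℤ)) '' (minusPart α V : Set G)

/-- `V` is a compact open subgroup which is tidy for `α`. -/
structure IsTidySubgroup {G : Type*} [Group G] [TopologicalSpace G] (α : G ≃ₜ* G)
    (V : Subgroup G) : Prop where
  isOpen : IsOpen (V : Set G)
  isCompact : IsCompact (V : Set G)
  T1 : (V : Set G) = (plusPart α V : Set G) * (minusPart α V : Set G)
  T2_plus : IsClosed (plusPlus α V)
  T2_minus : IsClosed (minusMinus α V)

/-- `α` is tidy: every identity neighbourhood contains a subgroup tidy for `α`. -/
def IsTidyAut {G : Type*} [Group G] [TopologicalSpace G] (α : G ≃ₜ* G) : Prop :=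
  ∀ U ∈ 𝓝 (1 : G), ∃ V : Subgroup G, IsTidySubgroup α V ∧ (V : Set G) ⊆ U

/-- The contraction group `U_α` of all `x` with `α ^ n (x) → 1` as `n → ∞`. -/
def contractionGroup {G : Type*} [Group G] [TopologicalSpace G] [IsTopologicalGroup G]
    (α : G ≃ₜ* G) : Subgroup G where
  carrier := {x | Tendsto (fun n : ℕ => autPow α (n : ℤ) x) atTop (𝓝 1)}
  one_mem' := by
    simp only [Set.mem_ofPred_eq, map_one]
    exact tendsto_const_nhds
  mul_mem' := by
    intro a b ha hb
    simpa using Tendsto.mul ha hb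
  inv_mem' := by
    intro a ha
    simpa using Tendsto.inv ha

/-- The Levi factor `M_α` of all `x` whose orbit `α ^ ℤ (x)` is relatively compact. -/
def leviFactor {G : Type*} [Group G] [TopologicalSpace G] [IsTopologicalGroup G]
    (α : G ≃ₜ* G) : Subgroup G where
  carrier := {x | IsCompact (closure (Set.range fun n : ℤ => autPow α n x))}
  one_mem' := by
    have h : (Set.range fun n : ℤ => autPow α n (1 : G)) = {1} := by
      simp
    show IsCompact (closure (Set.range fun n : ℤ => autPow α n (1 : G)))
    rw [h]
    exact isCompact_singleton.closure
  mul_mem' := by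
    intro a b ha hb
    refine (IsCompact.mul ha hb).closure_of_subset ?_
    rintro _ ⟨n, rfl⟩
    exact ⟨_, subset_closure ⟨n, rfl⟩, _, subset_closure ⟨n, rfl⟩, (map_mul _ _ _).symm⟩
  inv_mem' := by
    intro a ha
    refine (IsCompact.inv ha).closure_of_subset ?_
    rintro _ ⟨n, rfl⟩
    rw [Set.mem_inv]
    refine subset_closure ⟨n, ?_⟩
    simp

theorem apply_mem_leviFactor_iff {G : Type*} [Group G] [TopologicalSpace G] [IsTopologicalGroup G]
    (α : G ≃ₜ* G) (x : G) : α x ∈ leviFactor α ↔ x ∈ leviFactor α := by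
  have h : (Set.range fun n : ℤ => autPow α n (α x)) = Set.range fun n : ℤ => autPow α n x := by
    ext y
    constructor
    · rintro ⟨n, rfl⟩
      exact ⟨n + 1, autPow_add_one α n x⟩
    · rintro ⟨n, rfl⟩
      refine ⟨n - 1, ?_⟩
      have := autPow_add_one α (n - 1) x
      rw [sub_add_cancel] at this
      exact this.symm
  show IsCompact (closure (Set.range fun n : ℤ => autPow α n (α x))) ↔
    IsCompact (closure (Set.range fun n : ℤ => autPow α n x))
  rw [h]

/-- The restriction of `α` to an `α`-stable subgroup `H`, equipped with the subspace topology. -/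
def restrictAut {G : Type*} [Group G] [TopologicalSpace G] (α : G ≃ₜ* G) (H : Subgroup G)
    (hH : ∀ x, α x ∈ H ↔ x ∈ H) : H ≃ₜ* H where
  toFun x := ⟨α x, (hH x).2 x.2⟩
  invFun x := ⟨α.symm x, (hH _).1 (by simp)⟩
  left_inv x := Subtype.ext (α.symm_apply_apply x)
  right_inv x := Subtype.ext (α.apply_symm_apply x)
  map_mul' x y := Subtype.ext (map_mul α (x : G) (y : G))
  continuous_toFun := (α.continuous_toFun.comp continuous_subtype_val).subtype_mk _
  continuous_invFun := (α.continuous_invFun.comp continuous_subtype_val).subtype_mk _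

/-- The restriction of `α` to its Levi factor. -/
def leviRestrict {G : Type*} [Group G] [TopologicalSpace G] [IsTopologicalGroup G]
    (α : G ≃ₜ* G) : leviFactor α ≃ₜ* leviFactor α :=
  restrictAut α (leviFactor α) (apply_mem_leviFactor_iff α)

/-- The subgroup of all `x ∈ M_α` such that `α ^ n (x) ∈ O` for all sufficiently large `n`. -/
def eventualSubgroup {G : Type*} [Group G] [TopologicalSpace G] [IsTopologicalGroup G]
    (α : G ≃ₜ* G) (O : Subgroup G) : Subgroup G where
  carrier := {x | x ∈ leviFactor α ∧ ∀ᶠ n : ℕ in atTop, autPow α (n : ℤ) x ∈ O}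
  one_mem' := ⟨one_mem _, by simp [one_mem]⟩
  mul_mem' := by
    rintro a b ⟨ha, ha'⟩ ⟨hb, hb'⟩
    refine ⟨mul_mem ha hb, ?_⟩
    filter_upwards [ha', hb'] with n h1 h2
    rw [map_mul]
    exact mul_mem h1 h2
  inv_mem' := by
    rintro a ⟨ha, ha'⟩
    refine ⟨inv_mem ha, ?_⟩
    filter_upwards [ha'] with n h1
    rw [map_inv]
    exact inv_mem h1

/-- The subgroup `K`: the intersection, over all compact open subgroups `O` of `G`, of the closures
in `G` of the subgroups `eventualSubgroup α O`. -/
def tidyingK {G : Type*} [Group G] [TopologicalSpace G] [IsTopologicalGroup G]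
    (α : G ≃ₜ* G) : Subgroup G :=
  ⨅ (O : Subgroup G) (_ : IsCompact (O : Set G)) (_ : IsOpen (O : Set G)),
    (eventualSubgroup α O).topologicalClosure

/-- The subgroup `U₀`: the intersection of the closures of `U_α` and `U_{α⁻¹}`. -/
def contractionU0 {G : Type*} [Group G] [TopologicalSpace G] [IsTopologicalGroup G]
    (α : G ≃ₜ* G) : Subgroup G :=
  (contractionGroup α).topologicalClosure ⊓ (contractionGroup α.symm).topologicalClosure

/-! Call a compact open subgroup `O` of `G` adapted if `O ∩ M_α` is `α`-stable; formally,
`O ⊓ leviFactor α ≤ orbitCore α O ⊤`.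

If `V` is tidy for an automorphism all of whose orbits are relatively compact, then `V` is stable:
`V₋₋` is closed, hence a Baire space, and it is the increasing union of the closed subgroups
`⋂_{k ≥ n} α ^ (-k) (V)`, so every compact subset of `V₋₋`, in particular every orbit closure, lies
in one of them; this forces the orbit into `V`. The same holds for `V₊₊`, and `V = V₊V₋`. Applied to
`α` on `M_α`, this makes the tidy subgroups stable; thickening them to compact open subgroups of `G`
with the same trace on `M_α` yields adapted `O` with `O ∩ M_α` arbitrarily small.

It remains to see that `K` and `U₀` lie in `O ∩ M_α` for each adapted `O`. For `K` this is because
an orbit in `M_α` which meets `O` stays in `O`. For `U₀`, the group `V = ⋂_{0 ≤ k ≤ N} α ^ k (O)` is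
again adapted and satisfies `V = V₊V₋` for large `N`. An element of `V₋₋ ∩ V₊` has all but finitely
many orbit points in `V`, hence lies in `V ∩ M_α` and so in `V₋`. Therefore `V₋₋ ∩ V = V₋` is
closed, hence so is `V₋₋`, and likewise `V₊₊`; these contain `U_α` and `U_{α⁻¹}`, and
`V₋₋ ∩ V₊₊ ⊆ M_α ∩ V₋₋ ⊆ V`. -/

section TopologicalGroup

variable {G : Type*} [Group G] [TopologicalSpace G]

theorem eq_bot_of_forall_nhds_subset [T1Space G] {H : Subgroup G}
    (h : ∀ U ∈ 𝓝 (1 : G), (H : Set G) ⊆ U) : H = ⊥ := by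
  refine (Subgroup.eq_bot_iff_forall H).2 fun x hx => by_contra fun hx1 => ?_
  exact h {x}ᶜ (isOpen_compl_singleton.mem_nhds (Ne.symm hx1)) hx rfl

theorem exists_subset_of_isCompact_of_iUnion_eq_univ [SeparatelyContinuousMul G] [BaireSpace G]
    {F : ℕ → Subgroup G} (hmono : Monotone F) (hclosed : ∀ n, IsClosed (F n : Set G))
    (hcover : ⋃ n, (F n : Set G) = Set.univ) {C : Set G} (hC : IsCompact C) :
    ∃ n, C ⊆ F n := by
  obtain ⟨n, x, hx⟩ := nonempty_interior_of_iUnion_of_closed hclosed hcover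
  have hopen (m : ℕ) : IsOpen (F (n + m) : Set G) :=
    (F (n + m)).isOpen_of_mem_nhds <|
      mem_of_superset (mem_interior_iff_mem_nhds.1 hx) (hmono (Nat.le_add_right n m))
  have hcover' : C ⊆ ⋃ m, (F (n + m) : Set G) := by
    intro y _
    obtain ⟨m, hm⟩ := Set.mem_iUnion.1 (hcover.symm ▸ Set.mem_univ y)
    exact Set.mem_iUnion.2 ⟨m, hmono (Nat.le_add_left m n) hm⟩
  obtain ⟨m, hm⟩ := hC.elim_directed_cover _ hopen hcover' <|
    directed_of_isDirected_le fun a b hab => hmono (Nat.add_le_add_left hab n)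
  exact ⟨n + m, hm⟩

variable [IsTopologicalGroup G]

theorem isClosed_subgroup_of_isClosed_inter (H : Subgroup G) {N : Set G} (hN : IsOpen N)
    (h1 : (1 : G) ∈ N) (hHN : IsClosed ((H : Set G) ∩ N)) : IsClosed (H : Set G) := by
  refine isClosed_of_closure_subset fun x hx => ?_
  have hnhds : (fun y : G => y⁻¹ * x) ⁻¹' N ∈ 𝓝 x :=
    (hN.preimage (by fun_prop)).mem_nhds (by simpa using h1)
  obtain ⟨y, hyN, hyH⟩ := mem_closure_iff_nhds.1 hx _ hnhds
  have hyx : y⁻¹ * x ∈ closure ((H : Set G) ∩ N) :=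
    hN.closure_inter ⟨mul_mem (inv_mem (H.le_topologicalClosure hyH)) hx, hyN⟩
  exact (H.mul_mem_cancel_left (inv_mem hyH)).1 (hHN.closure_subset hyx).1

theorem iInter_mul_subset_mul_iInter {P : Set G} (hP : IsClosed P) {C : ℕ → Set G}
    (hanti : Antitone C) (hcompact : IsCompact (C 0)) (hclosed : ∀ n, IsClosed (C n)) :
    ⋂ n, P * C n ⊆ P * ⋂ n, C n := by
  intro u hu
  let D (n : ℕ) : Set G := C n ∩ {b | u * b⁻¹ ∈ P}
  have hDclosed (n : ℕ) : IsClosed (D n) := (hclosed n).inter (hP.preimage (by fun_prop))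
  have hDnonempty (n : ℕ) : (D n).Nonempty := by
    obtain ⟨a, ha, b, hb, rfl⟩ := Set.mem_iInter.1 hu n
    exact ⟨b, hb, by simpa using ha⟩
  obtain ⟨b, hb⟩ := IsCompact.nonempty_iInter_of_sequence_nonempty_isCompact_isClosed D
    (fun n => Set.inter_subset_inter_left _ (hanti n.le_succ)) hDnonempty
    (hcompact.inter_right (hP.preimage (by fun_prop))) hDclosed
  have hb (n : ℕ) : b ∈ D n := Set.mem_iInter.1 hb n
  exact ⟨u * b⁻¹, (hb 0).2, b, Set.mem_iInter.2 fun n => (hb n).1, inv_mul_cancel_right u b⟩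

theorem isOpen_stabilizer_of_isCompact_of_isOpen {C : Set G} (hC : IsCompact C)
    (hCo : IsOpen C) : IsOpen (MulAction.stabilizer G C : Set G) := by
  obtain ⟨S, hS, hSC⟩ := compact_open_separated_mul_left hC hCo subset_rfl
  have hsmul {s : G} (hs : s ∈ S) : s • C ⊆ C :=
    Set.smul_set_subset_iff.2 fun c hc => hSC (Set.mul_mem_mul hs hc)
  refine Subgroup.isOpen_of_mem_nhds _ (g := 1) ?_
  filter_upwards [hS, inv_mem_nhds_one G hS] with s hs hs'
  exact (hsmul hs).antisymm (Set.subset_smul_set_iff.2 (hsmul hs'))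

theorem exists_isOpen_isCompact_subset_of_mem_nhds_one [LocallyCompactSpace G]
    [TotallyDisconnectedSpace G] {U : Set G} (hU : U ∈ 𝓝 1) :
    ∃ T : Set G, IsOpen T ∧ IsCompact T ∧ 1 ∈ T ∧ T ⊆ U := by
  obtain ⟨Q, hQ, hQ1⟩ := exists_compact_mem_nhds (1 : G)
  obtain ⟨T, hT, h1T, hTs⟩ :=
    loc_compact_Haus_tot_disc_of_zero_dim.mem_nhds_iff.1 (inter_mem hU hQ1)
  exact ⟨T, hT.2, hQ.of_isClosed_subset hT.1 (hTs.trans Set.inter_subset_right), h1T,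
    hTs.trans Set.inter_subset_left⟩

theorem exists_isOpen_isCompact_subgroup_between [LocallyCompactSpace G]
    [TotallyDisconnectedSpace G] {W : Subgroup G} (hW : IsCompact (W : Set G)) {A : Set G}
    (hA : IsOpen A) (hWA : (W : Set G) ⊆ A) :
    ∃ O : Subgroup G, IsOpen (O : Set G) ∧ IsCompact (O : Set G) ∧ W ≤ O ∧ (O : Set G) ⊆ A := by
  obtain ⟨U, hU, hWU⟩ := compact_open_separated_mul_right hW hA hWA
  obtain ⟨T, hTo, hTc, h1T, hTU⟩ :=
    exists_isOpen_isCompact_subset_of_mem_nhds_one hU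
  have hCc : IsCompact ((W : Set G) * T) := hW.mul hTc
  -- `W * T` is compact, open and left `W`-invariant, so its stabilizer does the job.
  let O := MulAction.stabilizer G ((W : Set G) * T)
  have hOo : IsOpen (O : Set G) := isOpen_stabilizer_of_isCompact_of_isOpen hCc hTo.mul_left
  have hOC : (O : Set G) ⊆ W * T := fun g hg => by
    have h1 : (1 : G) ∈ (W : Set G) * T := ⟨1, one_mem W, 1, h1T, one_mul 1⟩
    simpa using (MulAction.mem_stabilizer_set.1 hg 1).2 h1
  have hWO : W ≤ O := fun w hw => by
    rw [MulAction.mem_stabilizer_iff, ← smul_mul_assoc, smul_coe_set hw]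
  exact ⟨O, hOo, hCc.of_isClosed_subset (O.isClosed_of_isOpen hOo) hOC, hWO,
    hOC.trans ((Set.mul_subset_mul_left hTU).trans hWU)⟩

end TopologicalGroup

section AutPow

variable {G : Type*} [Group G] [TopologicalSpace G]

theorem autPow_add (α : G ≃ₜ* G) (m n : ℤ) (x : G) :
    autPow α (m + n) x = autPow α m (autPow α n x) :=
  DFunLike.congr_fun (zpow_add (α.toMulEquiv : MulAut G) m n) x

theorem autPow_neg_autPow (α : G ≃ₜ* G) (n : ℤ) (x : G) :
    autPow α (-n) (autPow α n x) = x := by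
  rw [← autPow_add, neg_add_cancel, autPow_zero]

theorem autPow_autPow_neg (α : G ≃ₜ* G) (n : ℤ) (x : G) :
    autPow α n (autPow α (-n) x) = x := by
  rw [← autPow_add, add_neg_cancel, autPow_zero]

theorem autPow_sub_one (α : G ≃ₜ* G) (n : ℤ) (x : G) :
    autPow α (n - 1) x = autPow α n (α.symm x) := by
  simpa using (autPow_add_one α (n - 1) (α.symm x)).symm

theorem autPow_symm (α : G ≃ₜ* G) (n : ℤ) : autPow α.symm n = autPow α (-n) :=
  inv_zpow' (α.toMulEquiv : MulAut G) n

theorem continuous_autPow (α : G ≃ₜ* G) (n : ℤ) : Continuous (autPow α n) := by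
  induction n with
  | zero => exact continuous_id.congr fun x => (autPow_zero α x).symm
  | succ n ih => exact (ih.comp α.continuous_toFun).congr fun x => (autPow_add_one α n x).symm
  | pred n ih => exact (ih.comp α.continuous_invFun).congr fun x => (autPow_sub_one α (-n) x).symm

theorem coe_autPow_restrictAut (α : G ≃ₜ* G) (H : Subgroup G) (hH : ∀ x, α x ∈ H ↔ x ∈ H)
    (n : ℤ) (x : H) : (autPow (restrictAut α H hH) n x : G) = autPow α n x := by
  induction n generalizing x with
  | zero => simp only [autPow_zero]
  | succ n ih => rw [autPow_add_one, autPow_add_one, ih]; rfl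
  | pred n ih => rw [autPow_sub_one, autPow_sub_one, ih]; rfl

theorem mem_map_autPow (α : G ≃ₜ* G) (V : Subgroup G) (n : ℤ) (x : G) :
    x ∈ V.map (autPow α n).toMonoidHom ↔ autPow α (-n) x ∈ V := by
  constructor
  · rintro ⟨y, hy, rfl⟩
    simpa [autPow_neg_autPow] using hy
  · exact fun h => ⟨_, h, autPow_autPow_neg α n x⟩

end AutPow

section OrbitCore

variable {G : Type*} [Group G] [TopologicalSpace G] {α : G ≃ₜ* G} {V : Subgroup G}

/-- The subgroup of all `x` such that `α ^ k (x) ∈ V` for eventually all `k` along the filter `l`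
on `ℤ`. Taking for `l` a principal filter, `atTop` or `atBot` puts finite intersections of
translates `α ^ k (V)`, `V₊`, `V₋`, `V₊₊` and `V₋₋` on the same footing. -/
def orbitCore (α : G ≃ₜ* G) (V : Subgroup G) (l : Filter ℤ) : Subgroup G where
  carrier := {x | ∀ᶠ k in l, autPow α k x ∈ V}
  one_mem' := by simp [one_mem]
  mul_mem' ha hb := by
    filter_upwards [ha, hb] with k hak hbk
    rw [map_mul]
    exact mul_mem hak hbk
  inv_mem' ha := by
    filter_upwards [ha] with k hak
    rw [map_inv]
    exact inv_mem hak

theorem mem_orbitCore {l : Filter ℤ} {x : G} :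
    x ∈ orbitCore α V l ↔ ∀ᶠ k in l, autPow α k x ∈ V :=
  Iff.rfl

theorem mem_orbitCore_principal {s : Set ℤ} {x : G} :
    x ∈ orbitCore α V (𝓟 s) ↔ ∀ k ∈ s, autPow α k x ∈ V :=
  Iff.rfl

theorem mem_orbitCore_top {x : G} : x ∈ orbitCore α V ⊤ ↔ ∀ k, autPow α k x ∈ V :=
  eventually_top

theorem orbitCore_anti (α : G ≃ₜ* G) (V : Subgroup G) : Antitone (orbitCore α V) :=
  fun _ _ hl _ hx => hx.filter_mono hl

theorem orbitCore_sup (α : G ≃ₜ* G) (V : Subgroup G) (l l' : Filter ℤ) :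
    orbitCore α V (l ⊔ l') = orbitCore α V l ⊓ orbitCore α V l' :=
  Subgroup.ext fun _ => eventually_sup

theorem orbitCore_principal_le {s : Set ℤ} (hs : 0 ∈ s) : orbitCore α V (𝓟 s) ≤ V :=
  fun x hx => autPow_zero α x ▸ mem_orbitCore_principal.1 hx 0 hs

theorem orbitCore_le_orbitCore_orbitCore {s t u : Set ℤ} (h : s + t ⊆ u) :
    orbitCore α V (𝓟 u) ≤ orbitCore α (orbitCore α V (𝓟 s)) (𝓟 t) := by
  intro x hx
  simp only [mem_orbitCore_principal, ← autPow_add] at hx ⊢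
  exact fun k hk j hj => hx _ (h (Set.add_mem_add hj hk))

theorem autPow_mem_orbitCore {l l' : Filter ℤ} {k : ℤ} (h : Tendsto (· + k) l l') {x : G}
    (hx : x ∈ orbitCore α V l') : autPow α k x ∈ orbitCore α V l := by
  filter_upwards [h.eventually hx] with j hj
  rwa [← autPow_add]

theorem map_autPow_orbitCore (α : G ≃ₜ* G) (V : Subgroup G) (l : Filter ℤ) (n : ℤ) :
    (orbitCore α V l).map (autPow α n).toMonoidHom = orbitCore α V (l.map (· - n)) := by
  ext x
  simp only [mem_map_autPow, mem_orbitCore, eventually_map, ← autPow_add, ← sub_eq_add_neg]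

theorem orbitCore_symm (α : G ≃ₜ* G) (V : Subgroup G) (l : Filter ℤ) :
    orbitCore α.symm V l = orbitCore α V (l.map Neg.neg) := by
  ext x
  simp only [mem_orbitCore, eventually_map, autPow_symm]

theorem isClosed_orbitCore_principal (hV : IsClosed (V : Set G)) (s : Set ℤ) :
    IsClosed (orbitCore α V (𝓟 s) : Set G) := by
  have h : (orbitCore α V (𝓟 s) : Set G) = ⋂ k ∈ s, autPow α k ⁻¹' V := by
    ext x
    simp [mem_orbitCore_principal]
  exact h ▸ isClosed_biInter fun k _ => hV.preimage (continuous_autPow α k)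

theorem isOpen_orbitCore_principal (hV : IsOpen (V : Set G)) {s : Set ℤ} (hs : s.Finite) :
    IsOpen (orbitCore α V (𝓟 s) : Set G) := by
  have h : (orbitCore α V (𝓟 s) : Set G) = ⋂ k ∈ s, autPow α k ⁻¹' V := by
    ext x
    simp [mem_orbitCore_principal]
  exact h ▸ hs.isOpen_biInter fun k _ => hV.preimage (continuous_autPow α k)

theorem isCompact_orbitCore_principal (hV : IsClosed (V : Set G)) (hVc : IsCompact (V : Set G))
    {s : Set ℤ} (hs : 0 ∈ s) : IsCompact (orbitCore α V (𝓟 s) : Set G) :=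
  hVc.of_isClosed_subset (isClosed_orbitCore_principal hV s) (orbitCore_principal_le hs)

theorem exists_orbitCore_Icc_subset (hV : IsClosed (V : Set G)) (hVc : IsCompact (V : Set G))
    {A : Set G} (hA : IsOpen A) (hVA : (orbitCore α V (𝓟 (Set.Iic 0)) : Set G) ⊆ A) :
    ∃ N : ℕ, (orbitCore α V (𝓟 (Set.Icc (-N : ℤ) 0)) : Set G) ⊆ A := by
  have hinter : ⋂ N : ℕ, (orbitCore α V (𝓟 (Set.Icc (-N : ℤ) 0)) : Set G) ⊆
      orbitCore α V (𝓟 (Set.Iic 0)) := by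
    intro x hx k hk
    obtain ⟨N, rfl⟩ := Int.exists_eq_neg_ofNat hk
    exact Set.mem_iInter.1 hx N ⟨le_rfl, hk⟩
  refine exists_subset_nhds_of_isCompact' (directed_of_isDirected_le fun m n hmn => ?_)
    (fun N => isCompact_orbitCore_principal hV hVc (by simp))
    (fun N => isClosed_orbitCore_principal hV _)
    fun x hx => hA.mem_nhds (hVA (hinter hx))
  exact orbitCore_anti α V
    (principal_mono.2 (Set.Icc_subset_Icc_left (neg_le_neg (Int.ofNat_le.2 hmn))))

theorem subset_mul_orbitCore_Icc
    (h : (V : Set G) ⊆ orbitCore α V (𝓟 (Set.Iic 0)) * orbitCore α V (𝓟 (Set.Icc 0 1))) (n : ℕ) :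
    (V : Set G) ⊆ orbitCore α V (𝓟 (Set.Iic 0)) * orbitCore α V (𝓟 (Set.Icc 0 (n : ℤ))) := by
  induction n with
  | zero =>
    exact fun u hu => ⟨1, one_mem _, u, by simpa [mem_orbitCore_principal, autPow_zero], by simp⟩
  | succ n ih =>
    intro u hu
    obtain ⟨a, ha, b, hb, rfl⟩ := ih hu
    obtain ⟨a', ha', d, hd, hab⟩ := h (mem_orbitCore_principal.1 hb n (by simp))
    let e := autPow α (-n) a'
    let c := autPow α (-n) d
    have he : e ∈ orbitCore α V (𝓟 (Set.Iic (n : ℤ))) :=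
      autPow_mem_orbitCore (tendsto_principal_principal.2 fun j hj => by simpa using hj) ha'
    have hc : c ∈ orbitCore α V (𝓟 (Set.Icc (n : ℤ) (n + 1))) :=
      autPow_mem_orbitCore (tendsto_principal_principal.2 fun j hj => by grind) hd
    have hec : e * c = b := by
      rw [← map_mul]
      exact (congrArg _ hab).trans (autPow_neg_autPow α n b)
    have hc' : c ∈ orbitCore α V (𝓟 (Set.Icc 0 (n : ℤ))) := by
      rw [← mul_mem_cancel_left (orbitCore_anti α V (by grind [principal_mono]) he), hec]
      exact hb
    refine ⟨a * e, mul_mem ha (orbitCore_anti α V (by simp) he), c, ?_,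
      (mul_assoc a e c).trans (congrArg (a * ·) hec)⟩
    exact fun k hk => (le_total k n).elim (fun h => hc' ⟨hk.1, h⟩)
      (fun h => hc ⟨h, by exact_mod_cast hk.2⟩)

theorem minusPart_eq_orbitCore (α : G ≃ₜ* G) (V : Subgroup G) :
    minusPart α V = orbitCore α V (𝓟 (Set.Ici 0)) := by
  ext x
  simp only [minusPart, Subgroup.mem_iInf, mem_map_autPow, neg_neg, mem_orbitCore_principal,
    Set.mem_Ici]
  refine ⟨fun h k hk => ?_, fun h n => h n n.cast_nonneg⟩
  lift k to ℕ using hk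
  exact h k

theorem minusMinus_eq_orbitCore (α : G ≃ₜ* G) (V : Subgroup G) :
    minusMinus α V = orbitCore α V atTop := by
  have himage (n : ℕ) : autPow α (-(n : ℤ)) '' (minusPart α V : Set G) =
      orbitCore α V (𝓟 (Set.Ici (n : ℤ))) := by
    rw [minusPart_eq_orbitCore]
    simpa using congrArg SetLike.coe (map_autPow_orbitCore α V (𝓟 (Set.Ici 0)) (-n))
  ext x
  simp only [minusMinus, himage, Set.mem_iUnion, SetLike.mem_coe, mem_orbitCore,
    eventually_atTop]
  exact ⟨fun ⟨n, hn⟩ => ⟨n, hn⟩,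
    fun ⟨n, hn⟩ => ⟨n.toNat, fun k hk => hn k (n.self_le_toNat.trans hk)⟩⟩

theorem plusPart_eq_orbitCore (α : G ≃ₜ* G) (V : Subgroup G) :
    plusPart α V = orbitCore α V (𝓟 (Set.Iic 0)) := by
  have h : plusPart α V = minusPart α.symm V := by
    simp only [plusPart, minusPart, autPow_symm, neg_neg]
  simpa [minusPart_eq_orbitCore, orbitCore_symm] using h

theorem orbitCore_symm_atTop (α : G ≃ₜ* G) (V : Subgroup G) :
    orbitCore α.symm V atTop = orbitCore α V atBot := by
  rw [orbitCore_symm]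
  exact congrArg _ (OrderIso.neg ℤ).map_atTop

theorem plusPlus_eq_orbitCore (α : G ≃ₜ* G) (V : Subgroup G) :
    plusPlus α V = orbitCore α V atBot := by
  have h : plusPlus α V = minusMinus α.symm V := by
    simp only [plusPlus, minusMinus, plusPart, minusPart, autPow_symm, neg_neg]
  rw [h, minusMinus_eq_orbitCore, orbitCore_symm_atTop]

end OrbitCore

section Factorization

variable {G : Type*} [Group G] [TopologicalSpace G] [IsTopologicalGroup G] {α : G ≃ₜ* G}
  {V : Subgroup G}

theorem subset_mul_orbitCore_Ici (hV : IsClosed (V : Set G)) (hVc : IsCompact (V : Set G))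
    (h : (V : Set G) ⊆ orbitCore α V (𝓟 (Set.Iic 0)) * orbitCore α V (𝓟 (Set.Icc 0 1))) :
    (V : Set G) ⊆ orbitCore α V (𝓟 (Set.Iic 0)) * orbitCore α V (𝓟 (Set.Ici 0)) := by
  have hinter : ⋂ n : ℕ, (orbitCore α V (𝓟 (Set.Icc 0 (n : ℤ))) : Set G) ⊆
      orbitCore α V (𝓟 (Set.Ici 0)) := by
    intro x hx k hk
    lift k to ℕ using hk
    exact Set.mem_iInter.1 hx k ⟨k.cast_nonneg, le_rfl⟩
  refine (Set.subset_iInter (subset_mul_orbitCore_Icc h)).trans <|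
    (iInter_mul_subset_mul_iInter (isClosed_orbitCore_principal hV _) ?_ ?_ fun n =>
      isClosed_orbitCore_principal hV _).trans (Set.mul_subset_mul_left hinter)
  · exact fun m n hmn => orbitCore_anti α V
      (principal_mono.2 (Set.Icc_subset_Icc_right (Int.ofNat_le.2 hmn)))
  · exact isCompact_orbitCore_principal hV hVc (by simp)

theorem exists_orbitCore_Icc_subset_mul (hVo : IsOpen (V : Set G)) (hVc : IsCompact (V : Set G)) :
    ∃ N : ℕ, (orbitCore α V (𝓟 (Set.Icc (-N : ℤ) 0)) : Set G) ⊆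
      orbitCore α (orbitCore α V (𝓟 (Set.Icc (-N : ℤ) 0))) (𝓟 (Set.Iic 0)) *
        orbitCore α (orbitCore α V (𝓟 (Set.Icc (-N : ℤ) 0))) (𝓟 (Set.Ici 0)) := by
  have hV := V.isClosed_of_isOpen hVo
  obtain ⟨N, hN⟩ := exists_orbitCore_Icc_subset (α := α) hV hVc
    (A := orbitCore α V (𝓟 (Set.Iic 0)) * orbitCore α V (𝓟 (Set.Icc 0 1)))
    (isOpen_orbitCore_principal hVo (Set.finite_Icc 0 1)).mul_left
    (Set.subset_mul_left _ (one_mem _))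
  refine ⟨N, subset_mul_orbitCore_Ici (isClosed_orbitCore_principal hV _)
    (isCompact_orbitCore_principal hV hVc (by simp)) fun v hv => ?_⟩
  obtain ⟨a, ha, d, hd, rfl⟩ := hN hv
  have hdV : d ∈ orbitCore α V (𝓟 (Set.Icc (-N : ℤ) 0)) := by
    refine (mul_mem_cancel_left (orbitCore_anti α V ?_ ha)).1 hv
    exact principal_mono.2 Set.Icc_subset_Iic_self
  have hd' : d ∈ orbitCore α V (𝓟 (Set.Icc (-N : ℤ) 1)) := fun k hk =>
    (le_total k 0).elim (fun h => hdV ⟨hk.1, h⟩) (fun h => hd ⟨h, hk.2⟩)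
  refine ⟨a, orbitCore_le_orbitCore_orbitCore ?_ ha, d,
    orbitCore_le_orbitCore_orbitCore ?_ hd', rfl⟩
  · simpa using (Set.add_subset_add_right (Set.Icc_subset_Iic_self (a := (-N : ℤ)))).trans
      (Set.Iic_add_Iic_subset (0 : ℤ) 0)
  · simpa using Set.Icc_add_Icc_subset (-N : ℤ) 0 0 1

end Factorization

section LeviFactor

variable {G : Type*} [Group G] [TopologicalSpace G] [IsTopologicalGroup G] {α : G ≃ₜ* G}
  {V : Subgroup G}

theorem mem_leviFactor_of_mem_closure {x y : G} (hx : x ∈ leviFactor α)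
    (hy : y ∈ closure (Set.range fun n : ℤ => autPow α n x)) : y ∈ leviFactor α := by
  refine IsCompact.closure_of_subset hx ?_
  rintro _ ⟨n, rfl⟩
  refine map_mem_closure (continuous_autPow α n) hy ?_
  rintro _ ⟨k, rfl⟩
  exact ⟨n + k, autPow_add α n k x⟩

theorem autPow_mem_leviFactor {x : G} (hx : x ∈ leviFactor α) (n : ℤ) :
    autPow α n x ∈ leviFactor α :=
  mem_leviFactor_of_mem_closure hx (subset_closure ⟨n, rfl⟩)

theorem leviFactor_leviRestrict (α : G ≃ₜ* G) : leviFactor (leviRestrict α) = ⊤ := by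
  refine (Subgroup.eq_top_iff' _).2 fun x => ?_
  have horbit : Subtype.val '' (Set.range fun n : ℤ => autPow (leviRestrict α) n x) =
      Set.range fun n : ℤ => autPow α n (x : G) := by
    rw [← Set.range_comp]
    exact congrArg Set.range (funext fun n => coe_autPow_restrictAut α _ _ n x)
  have hclosure : closure (Set.range fun n : ℤ => autPow (leviRestrict α) n x) =
      Subtype.val ⁻¹' closure (Set.range fun n : ℤ => autPow α n (x : G)) :=
    horbit ▸ IsInducing.subtypeVal.closure_eq_preimage_closure_image _
  change IsCompact (closure (Set.range fun n : ℤ => autPow (leviRestrict α) n x))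
  rw [hclosure]
  refine IsInducing.subtypeVal.isCompact_preimage' x.2 fun y hy => ?_
  exact ⟨⟨y, mem_leviFactor_of_mem_closure x.2 hy⟩, rfl⟩

theorem orbitCore_cofinite_le_leviFactor (hVc : IsCompact (V : Set G)) :
    orbitCore α V cofinite ≤ leviFactor α := by
  intro x hx
  have hfinite : {k : ℤ | autPow α k x ∉ V}.Finite := eventually_cofinite.1 hx
  refine (hVc.union (hfinite.image fun k => autPow α k x).isCompact).closure_of_subset ?_
  rintro _ ⟨k, rfl⟩
  by_cases hk : autPow α k x ∈ V
  · exact Or.inl hk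
  · exact Or.inr ⟨k, hk, rfl⟩

theorem inf_leviFactor_eq_orbitCore_top (hVc : IsCompact (V : Set G))
    (hM : V ⊓ leviFactor α ≤ orbitCore α V ⊤) : V ⊓ leviFactor α = orbitCore α V ⊤ := by
  refine le_antisymm hM (le_inf ?_ ?_)
  · exact (principal_univ (α := ℤ)) ▸ orbitCore_principal_le (Set.mem_univ 0)
  · exact (orbitCore_anti α V le_top).trans (orbitCore_cofinite_le_leviFactor hVc)

theorem leviFactor_inf_orbitCore_le (hM : V ⊓ leviFactor α ≤ orbitCore α V ⊤) {l : Filter ℤ}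
    [l.NeBot] : leviFactor α ⊓ orbitCore α V l ≤ V := by
  rintro x ⟨hx, hxl⟩
  obtain ⟨k, hk⟩ := (mem_orbitCore.1 hxl).exists
  have hinv := mem_orbitCore_top.1 (hM ⟨hk, autPow_mem_leviFactor hx k⟩) (-k)
  rwa [autPow_neg_autPow] at hinv

theorem isClosed_orbitCore_of_subset_mul (hVo : IsOpen (V : Set G)) (hVc : IsCompact (V : Set G))
    (hM : V ⊓ leviFactor α ≤ orbitCore α V ⊤) {l : Filter ℤ} {s t : Set ℤ} (hl : l ≤ 𝓟 s)
    (ht : cofinite ≤ l ⊔ 𝓟 t) (h0 : 0 ∈ t)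
    (hV : (V : Set G) ⊆ orbitCore α V (𝓟 t) * orbitCore α V (𝓟 s)) :
    IsClosed (orbitCore α V l : Set G) := by
  have hinter : (orbitCore α V l : Set G) ∩ V = (orbitCore α V (𝓟 s) : Set G) ∩ V := by
    refine Set.Subset.antisymm ?_ (Set.inter_subset_inter_left _ (orbitCore_anti α V hl))
    rintro x ⟨hxl, hxV⟩
    obtain ⟨a, ha, b, hb, rfl⟩ := hV hxV
    have hal : a ∈ orbitCore α V l := (mul_mem_cancel_right (orbitCore_anti α V hl hb)).1 hxl
    have haM : a ∈ leviFactor α :=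
      orbitCore_cofinite_le_leviFactor hVc
        (orbitCore_anti α V ht (eventually_sup.2 ⟨hal, ha⟩))
    have has : a ∈ orbitCore α V (𝓟 s) :=
      orbitCore_anti α V le_top (hM ⟨orbitCore_principal_le h0 ha, haM⟩)
    exact ⟨mul_mem has hb, hxV⟩
  have hVcl := V.isClosed_of_isOpen hVo
  refine isClosed_subgroup_of_isClosed_inter _ hVo (one_mem V) ?_
  exact hinter ▸ (isClosed_orbitCore_principal hVcl s).inter hVcl

theorem contractionGroup_le_orbitCore_atTop (hVo : IsOpen (V : Set G)) :
    contractionGroup α ≤ orbitCore α V atTop := by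
  intro x hx
  rw [mem_orbitCore, ← Nat.map_cast_int_atTop, eventually_map]
  exact hx.eventually_mem (hVo.mem_nhds (one_mem V))

theorem contractionGroup_symm_le_orbitCore_atBot (hVo : IsOpen (V : Set G)) :
    contractionGroup α.symm ≤ orbitCore α V atBot :=
  orbitCore_symm_atTop α V ▸ contractionGroup_le_orbitCore_atTop hVo

theorem eventualSubgroup_eq_inf (α : G ≃ₜ* G) (V : Subgroup G) :
    eventualSubgroup α V = leviFactor α ⊓ orbitCore α V atTop := by
  ext x
  rw [Subgroup.mem_inf, mem_orbitCore, ← Nat.map_cast_int_atTop, eventually_map]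
  rfl

theorem tidyingK_le (hVo : IsOpen (V : Set G)) (hVc : IsCompact (V : Set G))
    (hM : V ⊓ leviFactor α ≤ orbitCore α V ⊤) : tidyingK α ≤ V ⊓ leviFactor α := by
  have hle : eventualSubgroup α V ≤ V ⊓ leviFactor α :=
    (eventualSubgroup_eq_inf α V).trans_le (le_inf (leviFactor_inf_orbitCore_le hM) inf_le_left)
  have hclosed : IsClosed ((V ⊓ leviFactor α : Subgroup G) : Set G) := by
    rw [inf_leviFactor_eq_orbitCore_top hVc hM, ← principal_univ]
    exact isClosed_orbitCore_principal (V.isClosed_of_isOpen hVo) _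
  exact (iInf_le_of_le V <| iInf_le_of_le hVc <| iInf_le _ hVo).trans
    ((eventualSubgroup α V).topologicalClosure_minimal hle hclosed)

theorem contractionU0_le_leviFactor_inf_orbitCore (hVo : IsOpen (V : Set G))
    (hVc : IsCompact (V : Set G)) (hM : V ⊓ leviFactor α ≤ orbitCore α V ⊤)
    (hV : (V : Set G) ⊆ orbitCore α V (𝓟 (Set.Iic 0)) * orbitCore α V (𝓟 (Set.Ici 0))) :
    contractionU0 α ≤ leviFactor α ⊓ orbitCore α V atTop := by
  have hV' : (V : Set G) ⊆ orbitCore α V (𝓟 (Set.Ici 0)) * orbitCore α V (𝓟 (Set.Iic 0)) := by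
    simpa only [mul_inv_rev, inv_coe_set] using Set.inv_subset_inv.2 hV
  have hTop : IsClosed (orbitCore α V atTop : Set G) :=
    isClosed_orbitCore_of_subset_mul hVo hVc hM (le_principal_iff.2 (Ici_mem_atTop 0))
      (by rw [Int.cofinite_eq, sup_comm]
          exact sup_le_sup_left (le_principal_iff.2 (Iic_mem_atBot 0)) _) Set.self_mem_Iic hV
  have hBot : IsClosed (orbitCore α V atBot : Set G) :=
    isClosed_orbitCore_of_subset_mul hVo hVc hM (le_principal_iff.2 (Iic_mem_atBot 0))
      (by rw [Int.cofinite_eq]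
          exact sup_le_sup_left (le_principal_iff.2 (Ici_mem_atTop 0)) _) Set.self_mem_Ici hV'
  have hcofinite : orbitCore α V atTop ⊓ orbitCore α V atBot ≤ leviFactor α := by
    rw [← orbitCore_sup, sup_comm, ← Int.cofinite_eq]
    exact orbitCore_cofinite_le_leviFactor hVc
  have hle : contractionU0 α ≤ orbitCore α V atTop ⊓ orbitCore α V atBot :=
    inf_le_inf
      (Subgroup.topologicalClosure_minimal _ (contractionGroup_le_orbitCore_atTop hVo) hTop)
      (Subgroup.topologicalClosure_minimal _ (contractionGroup_symm_le_orbitCore_atBot hVo) hBot)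
  exact le_inf (hle.trans hcofinite) (hle.trans inf_le_left)

theorem contractionU0_le {O : Subgroup G} (hOo : IsOpen (O : Set G)) (hOc : IsCompact (O : Set G))
    (hM : O ⊓ leviFactor α ≤ orbitCore α O ⊤) : contractionU0 α ≤ O ⊓ leviFactor α := by
  obtain ⟨N, hN⟩ := exists_orbitCore_Icc_subset_mul (α := α) hOo hOc
  let V := orbitCore α O (𝓟 (Set.Icc (-N : ℤ) 0))
  have hVO : V ≤ O := orbitCore_principal_le (by simp)
  have hMV : V ⊓ leviFactor α ≤ orbitCore α V ⊤ := by
    refine (inf_le_inf_right _ hVO).trans (hM.trans ?_)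
    simpa only [principal_univ] using
      orbitCore_le_orbitCore_orbitCore (Set.subset_univ (Set.Icc (-N : ℤ) 0 + Set.univ))
  have hle := contractionU0_le_leviFactor_inf_orbitCore
    (isOpen_orbitCore_principal hOo (Set.finite_Icc _ _))
    (isCompact_orbitCore_principal (O.isClosed_of_isOpen hOo) hOc (by simp)) hMV hN
  exact hle.trans (le_inf ((leviFactor_inf_orbitCore_le hMV).trans hVO) inf_le_left)

end LeviFactor

section Tidy

variable {G : Type*} [Group G] [TopologicalSpace G] [IsTopologicalGroup G] {α : G ≃ₜ* G}
  {V : Subgroup G}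

theorem leviFactor_inf_orbitCore_le_orbitCore_top [LocallyCompactSpace G] {l : Filter ℤ} [l.NeBot]
    [l.IsCountablyGenerated] (hl : ∀ k, Tendsto (· + k) l l) (hV : IsClosed (V : Set G))
    (hVl : IsClosed (orbitCore α V l : Set G)) :
    leviFactor α ⊓ orbitCore α V l ≤ orbitCore α V ⊤ := by
  rintro x ⟨hx, hxl⟩
  obtain ⟨s, hs⟩ := l.exists_antitone_basis
  let L := orbitCore α V l
  have : LocallyCompactSpace L := hVl.isClosedEmbedding_subtypeVal.locallyCompactSpace
  let F (n : ℕ) : Subgroup L := (orbitCore α V (𝓟 (s n))).subgroupOf L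
  have hmono : Monotone F := fun m n hmn =>
    Subgroup.comap_mono (orbitCore_anti α V (principal_mono.2 (hs.antitone hmn)))
  have hclosed (n : ℕ) : IsClosed (F n : Set L) :=
    (isClosed_orbitCore_principal hV (s n)).preimage continuous_subtype_val
  have hcover : ⋃ n, (F n : Set L) = Set.univ := by
    refine Set.eq_univ_of_forall fun y => ?_
    obtain ⟨n, -, hn⟩ := hs.toHasBasis.eventually_iff.1 y.2
    exact Set.mem_iUnion.2 ⟨n, fun k hk => hn hk⟩
  obtain ⟨n, hn⟩ := exists_subset_of_isCompact_of_iUnion_eq_univ hmono hclosed hcover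
    (hVl.isClosedEmbedding_subtypeVal.isCompact_preimage hx)
  obtain ⟨j, hj⟩ := nonempty_of_mem (hs.mem n)
  refine mem_orbitCore_top.2 fun k => ?_
  have hshift : autPow α (k - j) x ∈ L := autPow_mem_orbitCore (hl (k - j)) hxl
  have hmem := hn (a := ⟨_, hshift⟩) (subset_closure ⟨k - j, rfl⟩)
  simpa [← autPow_add] using mem_orbitCore_principal.1 hmem j hj

theorem IsTidySubgroup.le_orbitCore_top (hV : IsTidySubgroup α V) (hα : leviFactor α = ⊤) :
    V ≤ orbitCore α V ⊤ := by
  have : LocallyCompactSpace G :=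
    hV.isCompact.locallyCompactSpace_of_mem_nhds_of_group (hV.isOpen.mem_nhds (one_mem V))
  have hclosed := V.isClosed_of_isOpen hV.isOpen
  have hTop : orbitCore α V atTop ≤ orbitCore α V ⊤ := by
    simpa [hα] using leviFactor_inf_orbitCore_le_orbitCore_top (α := α) (l := atTop)
      (fun k => tendsto_atTop_add_const_right _ k tendsto_id) hclosed
      (minusMinus_eq_orbitCore α V ▸ hV.T2_minus)
  have hBot : orbitCore α V atBot ≤ orbitCore α V ⊤ := by
    simpa [hα] using leviFactor_inf_orbitCore_le_orbitCore_top (α := α) (l := atBot)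
      (fun k => tendsto_atBot_add_const_right _ k tendsto_id) hclosed
      (plusPlus_eq_orbitCore α V ▸ hV.T2_plus)
  intro x hx
  obtain ⟨a, ha, b, hb, rfl⟩ := (hV.T1.subset hx : x ∈ (plusPart α V : Set G) * minusPart α V)
  rw [plusPart_eq_orbitCore] at ha
  rw [minusPart_eq_orbitCore] at hb
  exact mul_mem (hBot (orbitCore_anti α V (le_principal_iff.2 (Iic_mem_atBot 0)) ha))
    (hTop (orbitCore_anti α V (le_principal_iff.2 (Ici_mem_atTop 0)) hb))

theorem exists_inf_leviFactor_le_orbitCore_top [LocallyCompactSpace G]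
    [TotallyDisconnectedSpace G] (hα : IsTidyAut (leviRestrict α)) {U : Set G} (hU : U ∈ 𝓝 1) :
    ∃ O : Subgroup G, IsOpen (O : Set G) ∧ IsCompact (O : Set G) ∧
      O ⊓ leviFactor α ≤ orbitCore α O ⊤ ∧ ((O ⊓ leviFactor α : Subgroup G) : Set G) ⊆ U := by
  obtain ⟨V, hV, hVU⟩ := hα (Subtype.val ⁻¹' U) (continuous_subtype_val.continuousAt hU)
  obtain ⟨A, hA, hAV⟩ := isOpen_induced_iff.1 hV.isOpen
  let W := V.map (leviFactor α).subtype
  have hW : IsCompact (W : Set G) := hV.isCompact.image continuous_subtype_val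
  have hWA : (W : Set G) ⊆ A := by
    rintro _ ⟨v, hv, rfl⟩
    exact hAV.symm.subset hv
  obtain ⟨O, hOo, hOc, hWO, hOA⟩ := exists_isOpen_isCompact_subgroup_between hW hA hWA
  have hOV {x : G} (hxO : x ∈ O) (hxM : x ∈ leviFactor α) : (⟨x, hxM⟩ : leviFactor α) ∈ V :=
    hAV.subset (hOA hxO)
  refine ⟨O, hOo, hOc, ?_, fun x hx => hVU (hOV hx.1 hx.2)⟩
  rintro x ⟨hxO, hxM⟩
  refine mem_orbitCore_top.2 fun k => hWO ?_
  refine ⟨_, mem_orbitCore_top.1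
    (hV.le_orbitCore_top (leviFactor_leviRestrict α) (hOV hxO hxM)) k, ?_⟩
  exact coe_autPow_restrictAut α _ _ k ⟨x, hxM⟩

end Tidy

theorem lemma2 {G : Type*} [Group G] [TopologicalSpace G] [IsTopologicalGroup G]
    [LocallyCompactSpace G] [TotallyDisconnectedSpace G] (α : G ≃ₜ* G)
    (hα : IsTidyAut (leviRestrict α)) :
    tidyingK α = ⊥ ∧ contractionU0 α = ⊥ := by
  have hsmall (U : Set G) (hU : U ∈ 𝓝 1) :
      (tidyingK α : Set G) ⊆ U ∧ (contractionU0 α : Set G) ⊆ U := by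
    obtain ⟨O, hOo, hOc, hM, hOU⟩ := exists_inf_leviFactor_le_orbitCore_top hα hU
    exact ⟨(SetLike.coe_subset_coe.2 (tidyingK_le hOo hOc hM)).trans hOU,
      (SetLike.coe_subset_coe.2 (contractionU0_le hOo hOc hM)).trans hOU⟩
  exact ⟨eq_bot_of_forall_nhds_subset fun U hU => (hsmall U hU).1,
    eq_bot_of_forall_nhds_subset fun U hU => (hsmall U hU).2⟩
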